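/- Let $M$ be a smooth $4n$-dimensional manifold with an almost quaternionic structure $\mathcal Q\subset \mathrm{End}(TM)$, i.e. a rank-3 subbundle locally spanned by smooth almost hypercomplex structures $(J_1,J_2,J_3)$ ($J_a^2=-\mathrm{id}$, $J_1J_2=-J_2J_1=J_3$; such local triples are called admissible bases). Let $Z=\{J\in\mathcal Q_x : x\in M,\ J^2=-\mathrm{id}\}\subset \mathrm{End}(TM)$ be its twistor space. A quaternionic connection is a smooth linear connection $\nabla$ on $TM$ such that $\nabla_X\sigma\in\Gamma(\mathcal Q)$ for all vector fields $X$ and all smooth (local) sections $\sigma$ of $\mathcal Q$. It induces a splitting of $T_JZ$, $J\in Z\cap\mathcal Q_x$, into the vertical space $V_J=\{A\in\mathcal Q_x : AJ+JA=0\}$ and the horizontal space, consisting of the horizontal lifts $Y^h$ of the vectors $Y\in T_xM$, and the almost complex structure $I_2^\nabla$ on $Z$ is given by $I_2^\nabla A=-JA$ for $A\in V_J$ and $I_2^\nabla Y^h=(JY)^h$ for $Y\in T_xM$. Let $\nabla,\nabla'$ be two quaternionic connections and $S_X=\nabla'_X-\nabla_X$ their difference tensor. With respect to every admissible basis $(J_1,J_2,J_3)$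 over an open set $U\subset M$, there are unique 1-forms $s^1,s^2,s^3$ (given at each point of $U$ by linear functionals on the tangent space) such that $$S_XY=S^0_XY+s^1(X)J_1Y+s^2(X)J_2Y+s^3(X)J_3Y,\qquad [S^0_X,J_a]=0,\ a=1,2,3 .$$ The following two conditions are equivalent: (i) $I_2^{\nabla}=I_2^{\nabla'}$ on $Z$; (ii) the 1-forms $s^1,s^2,s^3$ vanish identically, for every admissible local basis of $\mathcal Q$. -/

import Mathlib

open Bundle Filter
open scoped Manifold ContDiff Topology

noncomputable section

/-- The model space of a `4n`-dimensional manifold. -/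
abbrev QModel (n : ℕ) : Type := EuclideanSpace ℝ (Fin (4 * n))

section Endomorphisms

variable (n : ℕ) {M : Type*} [TopologicalSpace M] [ChartedSpace (QModel n) M]

/-- The endomorphisms of the tangent space at `x`, i.e. the fibre of `End(TM)` over `x`. -/
abbrev EndFiber (x : M) : Type :=
  TangentSpace (𝓡 (4 * n)) x →L[ℝ] TangentSpace (𝓡 (4 * n)) x

variable (M) in
/-- The total space of the vector bundle `End(TM) → M`. -/
abbrev EndTotal [IsManifold (𝓡 (4 * n)) ∞ M] : Type _ :=
  TotalSpace (QModel n →L[ℝ] QModel n) (fun x : M => EndFiber n x)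

/-- The model with corners of the manifold `End(TM)`. -/
abbrev endModel : ModelWithCorners ℝ (QModel n × (QModel n →L[ℝ] QModel n))
    (ModelProd (QModel n) (QModel n →L[ℝ] QModel n)) :=
  (𝓡 (4 * n)).prod 𝓘(ℝ, QModel n →L[ℝ] QModel n)

variable {n} [IsManifold (𝓡 (4 * n)) ∞ M]

/-- A (rough) section of `End(TM)`, seen as a map into the total space. -/
def endSection (σ : ∀ x : M, EndFiber n x) (x : M) : EndTotal n M := ⟨x, σ x⟩

/-- A linear connection on `TM`, as a covariant derivative. Note the order of the arguments:
`D Y x v` is `∇_v Y` at the point `x`. -/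
abbrev TangentConnection (n : ℕ) (M : Type*) [TopologicalSpace M] [ChartedSpace (QModel n) M]
    [IsManifold (𝓡 (4 * n)) ∞ M] : Type _ :=
  CovariantDerivative (𝓡 (4 * n)) (QModel n) (TangentSpace (𝓡 (4 * n)) : M → Type _)

/-- The operation `Y ↦ ∇_v (σ Y) - σ (∇_v Y)` is tensorial in `Y`. -/
theorem endDeriv_tensorial (D : TangentConnection n M) (σ : ∀ x : M, EndFiber n x) (x : M)
    (hσ : MDifferentiableAt (𝓡 (4 * n)) (endModel n) (endSection σ) x)
    (v : TangentSpace (𝓡 (4 * n)) x) :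
    TensorialAt (𝓡 (4 * n)) (QModel n)
      (fun Y : ∀ y : M, TangentSpace (𝓡 (4 * n)) y =>
        D (fun y => σ y (Y y)) x v - σ x (D Y x v)) x where
  smul {f Y} hf hY := by
    have h1 : (fun y => σ y ((f • Y) y)) = f • fun y => σ y (Y y) := by
      ext1 y; simp
    have hσY := MDifferentiableAt.clm_bundle_apply (b := fun y : M => y) (ϕ := σ) hσ hY
    rw [h1, D.isCovariantDerivativeOnUniv.leibniz hσY hf,
      D.isCovariantDerivativeOnUniv.leibniz hY hf]
    simp [smul_sub]
  add {Y Y'} hY hY' := by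
    have h1 : (fun y => σ y ((Y + Y') y)) = (fun y => σ y (Y y)) + fun y => σ y (Y' y) := by
      ext1 y; simp
    have hσY := MDifferentiableAt.clm_bundle_apply (b := fun y : M => y) (ϕ := σ) hσ hY
    have hσY' := MDifferentiableAt.clm_bundle_apply (b := fun y : M => y) (ϕ := σ) hσ hY'
    rw [h1, D.isCovariantDerivativeOnUniv.add hσY hσY',
      D.isCovariantDerivativeOnUniv.add hY hY']
    simp
    abel

/-- The connection induced on `End(TM)`: for a section `σ` differentiable at `x`, the endomorphism
`∇_v σ` of `T_x M` is given by `(∇_v σ) Y = ∇_v (σ Y) - σ (∇_v Y)`. -/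
def endDeriv (D : TangentConnection n M) (σ : ∀ x : M, EndFiber n x) (x : M)
    (hσ : MDifferentiableAt (𝓡 (4 * n)) (endModel n) (endSection σ) x)
    (v : TangentSpace (𝓡 (4 * n)) x) : EndFiber n x :=
  TensorialAt.mkHom _ x (endDeriv_tensorial D σ x hσ v)

end Endomorphisms

section Quaternionic

variable {n : ℕ} {M : Type*} [TopologicalSpace M] [ChartedSpace (QModel n) M]
  [IsManifold (𝓡 (4 * n)) ∞ M]

/-- `J 0, J 1, J 2` is an almost hypercomplex structure on the open set `U` which spans `Q`: the
`J a` are smooth sections of `End(TM)` over `U`, they satisfy `J_a² = -id` and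
`J_1 J_2 = - J_2 J_1 = J_3`, and they span `Q_x` for all `x` in `U`. -/
structure IsAdmissibleBasis (Q : ∀ x : M, Submodule ℝ (EndFiber n x)) (U : Set M)
    (J : Fin 3 → ∀ x : M, EndFiber n x) : Prop where
  isOpen : IsOpen U
  smooth : ∀ a, ContMDiffOn (𝓡 (4 * n)) (endModel n) ∞ (endSection (J a)) U
  sq : ∀ a, ∀ x ∈ U, (J a x).comp (J a x) = -ContinuousLinearMap.id ℝ _
  mul₁₂ : ∀ x ∈ U, (J 0 x).comp (J 1 x) = J 2 x
  mul₂₁ : ∀ x ∈ U, (J 1 x).comp (J 0 x) = -J 2 x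
  span : ∀ x ∈ U, Submodule.span ℝ (Set.range fun a => J a x) = Q x

variable (n M) in
/-- An almost quaternionic structure on `M`: a rank-3 subbundle of `End(TM)` which is locally
spanned by an almost hypercomplex structure. -/
structure AlmostQuaternionicStructure where
  /-- the fibre `Q_x`, a space of endomorphisms of `T_x M` -/
  fiber : ∀ x : M, Submodule ℝ (EndFiber n x)
  rank_eq : ∀ x, Module.finrank ℝ (fiber x) = 3
  exists_basis : ∀ x : M, ∃ (U : Set M) (J : Fin 3 → ∀ y : M, EndFiber n y),
    x ∈ U ∧ IsAdmissibleBasis fiber U J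

/-- A quaternionic connection: a smooth linear connection on `TM` that preserves `Q`, i.e.
`∇_v σ` lies in `Q` for every smooth (local) section `σ` of `Q`. -/
structure IsQuaternionicConnection (Q : AlmostQuaternionicStructure n M)
    (D : TangentConnection n M) : Prop where
  smooth : CovariantDerivative.ContMDiffCovariantDerivative D ∞
  preserves : ∀ (U : Set M) (σ : ∀ x : M, EndFiber n x), IsOpen U →
    ContMDiffOn (𝓡 (4 * n)) (endModel n) ∞ (endSection σ) U → (∀ x ∈ U, σ x ∈ Q.fiber x) →
    ∀ x ∈ U, ∀ hσ : MDifferentiableAt (𝓡 (4 * n)) (endModel n) (endSection σ) x,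
    ∀ v : TangentSpace (𝓡 (4 * n)) x, endDeriv D σ x hσ v ∈ Q.fiber x

/-- The twistor space `Z ⊆ End(TM)`: all the complex structures `J` on tangent spaces of `M` that
belong to the almost quaternionic structure. -/
def twistorSpace (Q : AlmostQuaternionicStructure n M) : Set (EndTotal n M) :=
  {p | p.2 ∈ Q.fiber p.1 ∧ p.2.comp p.2 = -ContinuousLinearMap.id ℝ _}

/-- The tangent space of the twistor space at `p`, as a subspace of the tangent space of the
manifold `End(TM)`: it is spanned by the velocities of the smooth curves in `Z` through `p`. -/
def twistorTangent (Q : AlmostQuaternionicStructure n M) (p : EndTotal n M) :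
    Submodule ℝ (TangentSpace (endModel n) p) :=
  Submodule.span ℝ {W | ∃ γ : ℝ → EndTotal n M,
    ContMDiffAt 𝓘(ℝ, ℝ) (endModel n) ∞ γ 0 ∧
    (∀ᶠ t in 𝓝 (0 : ℝ), γ t ∈ twistorSpace Q) ∧
    (tangentMap 𝓘(ℝ, ℝ) (endModel n) γ ⟨0, (1 : ℝ)⟩ : TangentBundle (endModel n) (EndTotal n M)) =
      ⟨p, W⟩}

/-- The differential of the bundle projection `End(TM) → M`. -/
def projDeriv (p : EndTotal n M) :
    TangentSpace (endModel n) p →L[ℝ] TangentSpace (𝓡 (4 * n)) p.1 :=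
  mfderiv (endModel n) (𝓡 (4 * n)) (fun q : EndTotal n M => q.1) p

/-- The vertical vector at `p` given by an endomorphism `A`: the velocity at `t = 0` of the curve
`t ↦ p + t A` in the fibre through `p`. -/
def vertVec (p : EndTotal n M) (A : EndFiber n p.1) : TangentSpace (endModel n) p :=
  (tangentMap 𝓘(ℝ, ℝ) (endModel n) (fun t : ℝ => (⟨p.1, p.2 + t • A⟩ : EndTotal n M))
    ⟨0, (1 : ℝ)⟩).2

/-- The horizontal lift of `v ∈ T_x M` at a point `p = J` of the fibre of `End(TM)` over `x`, with
respect to the induced connection: `dσ(v) - ∇_v σ`, where `σ` is a section through `J` and `∇_v σ` is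
regarded as a vertical vector. It does not depend on `σ`; here `σ` is the section that is constant
in the preferred trivialization at `x`. -/
def horLift (D : TangentConnection n M) (p : EndTotal n M) (v : TangentSpace (𝓡 (4 * n)) p.1) :
    TangentSpace (endModel n) p :=
  let dσ : TangentSpace (endModel n) p := mfderiv (𝓡 (4 * n)) (endModel n)
      (endSection (FiberBundle.extend (QModel n →L[ℝ] QModel n) p.2)) p.1 v
  dσ - vertVec p (endDeriv D (FiberBundle.extend (QModel n →L[ℝ] QModel n) p.2) p.1
      (FiberBundle.mdifferentiableAt_extend ..) v)

/-! Helper facts: in the product coordinates on the tangent spaces of `End(TM)`, a vertical vector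
is `(0, A)`, and a horizontal lift of `v` has first component `v`. They give the decomposition of
a tangent vector into a horizontal and a vertical part. -/

section Helpers

variable {EN : Type*} [NormedAddCommGroup EN] [NormedSpace ℝ EN] {HN : Type*} [TopologicalSpace HN] {IN : ModelWithCorners ℝ EN HN} {N : Type*} [TopologicalSpace N] [ChartedSpace HN N]

theorem hasMFDerivAt_endTotal (f : N → EndTotal n M) (z : N) (hc : ContinuousAt f z)
   (L1 : EN →L[ℝ] QModel n) (L2 : EN →L[ℝ] (QModel n →L[ℝ] QModel n))
   (h1 : HasMFDerivAt IN (𝓡 (4*n)) (fun y => (f y).1) z L1)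
   (h2 : HasMFDerivAt IN 𝓘(ℝ, QModel n →L[ℝ] QModel n) (fun y => (trivializationAt (QModel n →L[ℝ] QModel n) (fun x : M => EndFiber n x) (f z).1 (f y)).2) z L2) :
   HasMFDerivAt IN (endModel n) f z (L1.prod L2) := by
  refine ⟨hc, ?_⟩
  have := HasFDerivWithinAt.prodMk h1.2 h2.2
  have hb : (fun x => (f x).proj) ⁻¹' (trivializationAt (QModel n →L[ℝ] QModel n) (fun x : M => EndFiber n x) (f z).proj).baseSet ∈ 𝓝 z :=
    ((FiberBundle.continuous_proj (QModel n →L[ℝ] QModel n) (fun x : M => EndFiber n x)).continuousAt.comp hc)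
      ((Trivialization.open_baseSet _).mem_nhds (FiberBundle.mem_baseSet_trivializationAt (QModel n →L[ℝ] QModel n) (fun x : M => EndFiber n x) _))
  have hb' := extChartAt_preimage_mem_nhds (I := IN) hb
  refine this.congr_of_eventuallyEq ?_ ?_
  · filter_upwards [mem_nhdsWithin_of_mem_nhds hb'] with y hy
    simp only [writtenInExtChartAt, FiberBundle.extChartAt, Function.comp]
    simp
    exact ⟨congrArg _ (Trivialization.coe_fst' _ hy), rfl⟩
  · simp only [writtenInExtChartAt, FiberBundle.extChartAt, Function.comp]
    simp
    rfl

end Helpers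

theorem projDeriv_eq (p : EndTotal n M) (W : TangentSpace (endModel n) p) : projDeriv p W = Prod.fst (α := QModel n) (β := QModel n →L[ℝ] QModel n) W := by
  have h : HasMFDerivAt (endModel n) (endModel n) (id : EndTotal n M → EndTotal n M) p _ :=
    hasMFDerivAt_endTotal (id : EndTotal n M → EndTotal n M) p continuousAt_id _ _
     ((Bundle.mdifferentiableAt_proj _).hasMFDerivAt) (((mdifferentiableAt_totalSpace _ (id : EndTotal n M → EndTotal n M)).1 mdifferentiableAt_id).2.hasMFDerivAt)
  have h2 := hasMFDerivAt_unique h (hasMFDerivAt_id _)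
  exact congrArg Prod.fst (DFunLike.congr_fun h2 W)

theorem triv_self (x : M) (A : EndFiber n x) :
   (trivializationAt (QModel n →L[ℝ] QModel n) (fun x : M => EndFiber n x) x ⟨x, A⟩).2 = A := by
  rw [hom_trivializationAt_apply]
  ext1 v
  simp only [ContinuousLinearMap.inCoordinates]
  have h := mem_chart_source (QModel n) x
  simp only [ContinuousLinearMap.comp_apply]
  rw [TangentBundle.continuousLinearMapAt_trivializationAt_eq_core h,
   TangentBundle.symmL_trivializationAt_eq_core h]
  have : ∀ w, ((tangentBundleCore (𝓡 (4*n)) M).coordChange (achart (QModel n) x) (achart (QModel n) x) x) w = w := fun w =>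
   (tangentBundleCore (𝓡 (4*n)) M).coordChange_self _ _ (by simp) w
  erw [this, this]
  rfl

theorem vertVec_eq (p : EndTotal n M) (A : EndFiber n p.1) :
    vertVec p A = ((0 : QModel n), (A : QModel n →L[ℝ] QModel n)) := by
  have e : (fun t : ℝ => (trivializationAt (QModel n →L[ℝ] QModel n) (fun x : M => EndFiber n x) p.1 ⟨p.1, p.2 + t • A⟩).2) = fun t : ℝ => (show QModel n →L[ℝ] QModel n from p.2) + t • (show QModel n →L[ℝ] QModel n from A) := funext fun t => triv_self _ _
  have hd : HasFDerivAt (fun t : ℝ => (show QModel n →L[ℝ] QModel n from p.2) + t • (show QModel n →L[ℝ] QModel n from A)) (ContinuousLinearMap.toSpanSingleton ℝ (show QModel n →L[ℝ] QModel n from A)) (0:ℝ) := by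
    have := ((hasDerivAt_id (0:ℝ)).smul_const (show QModel n →L[ℝ] QModel n from A)).const_add (show QModel n →L[ℝ] QModel n from p.2)
    rw [one_smul] at this
    exact this.hasFDerivAt
  have hd2 : HasMFDerivAt 𝓘(ℝ,ℝ) 𝓘(ℝ, QModel n →L[ℝ] QModel n) (fun t : ℝ => (trivializationAt (QModel n →L[ℝ] QModel n) (fun x : M => EndFiber n x) p.1 (⟨p.1, p.2 + t • A⟩ : EndTotal n M)).2) 0 (ContinuousLinearMap.toSpanSingleton ℝ (show QModel n →L[ℝ] QModel n from A)) := by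
    erw [e]
    exact hd.hasMFDerivAt
  have hc : ContinuousAt (fun t : ℝ => (⟨p.1, p.2 + t • A⟩ : EndTotal n M)) 0 := by
    rw [FiberBundle.continuousAt_totalSpace]
    exact ⟨continuousAt_const, hd2.continuousAt⟩
  have := hasMFDerivAt_endTotal (fun t : ℝ => (⟨p.1, p.2 + t • A⟩ : EndTotal n M)) (0:ℝ) hc 0 _ (hasMFDerivAt_const _ _) hd2
  unfold vertVec tangentMap
  rw [this.mfderiv]
  exact Prod.ext rfl (one_smul ℝ _)

theorem horLift_fst (D : TangentConnection n M) (p : EndTotal n M) (v : TangentSpace (𝓡 (4 * n)) p.1) :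
    Prod.fst (α := QModel n) (β := QModel n →L[ℝ] QModel n) (horLift D p v) = v := by
  have hd := FiberBundle.mdifferentiableAt_extend (𝓡 (4*n)) (QModel n →L[ℝ] QModel n) p.2
  have := hasMFDerivAt_endTotal (endSection (FiberBundle.extend (QModel n →L[ℝ] QModel n) p.2)) p.1
    hd.continuousAt (ContinuousLinearMap.id ℝ _) _ (hasMFDerivAt_id _) (((mdifferentiableAt_totalSpace _ _).1 hd).2.hasMFDerivAt)
  unfold horLift
  rw [vertVec_eq, this.mfderiv]
  exact sub_zero _

theorem existsUnique_vert (D : TangentConnection n M) (p : EndTotal n M) (W : TangentSpace (endModel n) p) :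
   ∃! A : EndFiber n p.1, W = horLift D p (projDeriv p W) + vertVec p A := by
  obtain ⟨B, hB⟩ : ∃ B : EndFiber n p.1, B = Prod.snd (α := QModel n)
      (β := QModel n →L[ℝ] QModel n) (W - horLift D p (projDeriv p W)) := ⟨_, rfl⟩
  refine ⟨B, ?_, ?_⟩
  · dsimp only
    rw [vertVec_eq]
    refine Prod.ext ?_ ?_
    · have := horLift_fst D p (projDeriv p W)
      have h2 := projDeriv_eq p W
      exact (h2.symm.trans this.symm).trans (add_zero _).symm
    · have h3 : Prod.snd (α := QModel n) (β := QModel n →L[ℝ] QModel n) W = Prod.snd (α := QModel n) (β := QModel n →L[ℝ] QModel n) (horLift D p (projDeriv p W)) + (show QModel n →L[ℝ] QModel n from B) := by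
        rw [hB]
        exact (add_sub_cancel _ _).symm
      exact h3
  · intro A hA
    have : W - horLift D p (projDeriv p W) = vertVec p A := by
      rw [sub_eq_iff_eq_add']; exact hA
    rw [hB, this, vertVec_eq]

/-- The vertical part `vW` of a tangent vector `W` of `End(TM)` at `p` with respect to the splitting
into vertical and horizontal vectors given by the connection, as an endomorphism of `T_x M`: the
unique `A` such that `W` is the sum of the horizontal lift of its projection to `M` and the vertical
vector given by `A`. -/
def vertPart (D : TangentConnection n M) (p : EndTotal n M) (W : TangentSpace (endModel n) p) :
    EndFiber n p.1 :=
  (existsUnique_vert D p W).choose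

/-- The almost complex structure `I₂` of the connection: at the point `p = J` of the twistor space,
`I₂` sends a vertical vector `A` to `-J A` and the horizontal lift of `v` to the horizontal lift
of `J v`. The formula makes sense for all tangent vectors of `End(TM)` at `p`; the almost complex
structure on the twistor space is its restriction to the tangent space of the twistor space. -/
def almostComplexTwo (D : TangentConnection n M) (p : EndTotal n M)
    (W : TangentSpace (endModel n) p) : TangentSpace (endModel n) p :=
  horLift D p (p.2 (projDeriv p W)) - vertVec p (p.2.comp (vertPart D p W))

/-- The almost complex structures `I₂` of two connections coincide on the twistor space. -/
def SameAlmostComplexTwo (Q : AlmostQuaternionicStructure n M) (D D' : TangentConnection n M) :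
    Prop :=
  ∀ p ∈ twistorSpace Q, ∀ W ∈ twistorTangent Q p, almostComplexTwo D p W = almostComplexTwo D' p W

/-- The difference tensor `S = ∇' - ∇`, with `S_X Y = ∇'_X Y - ∇_X Y` at the point `x`. -/
def diffTensor (D D' : TangentConnection n M) (x : M) (X Y : TangentSpace (𝓡 (4 * n)) x) :
    TangentSpace (𝓡 (4 * n)) x :=
  D'.difference D x Y X

/-- `s 0, s 1, s 2` are the `sp(1)`-components at `x` of the difference tensor `S = ∇' - ∇` with
respect to the basis `J 0, J 1, J 2` of `Q_x`:
`S_X Y = S⁰_X Y + ∑ s_a(X) J_a Y`, where all `S⁰_X` commute with all `J_a`. -/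
def IsSpOneComponents (D D' : TangentConnection n M) (x : M) (J : Fin 3 → EndFiber n x)
    (s : Fin 3 → (TangentSpace (𝓡 (4 * n)) x →L[ℝ] ℝ)) : Prop :=
  ∃ S₀ : TangentSpace (𝓡 (4 * n)) x →L[ℝ] EndFiber n x,
    (∀ X a, (S₀ X).comp (J a) = (J a).comp (S₀ X)) ∧
    ∀ X Y, diffTensor D D' x X Y = S₀ X Y + ∑ a, s a X • J a Y

end Quaternionic

end

/-! Write `S = ∇' - ∇`. The two connections on `End(TM)` differ by `σ ↦ [S_X, σ]`, and both preserve
`Q`, so `[S_X, ·]` maps `Q_x` to itself. Differentiating `J_a J_b + J_b J_a = -2δ_ab` shows that its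
matrix in the basis `J_a` is skew, hence it is the commutator with some `s(X) = ∑ s_a(X) J_a`
(`exists_commute_sub`). Only the zero combination of the `J_a` commutes with all `J_b`, so `s(X)` is
unique and therefore linear in `X`.

Passing from `∇` to `∇'` subtracts the vertical vector `[S_v, J]` from the horizontal lift of `v` at
`J`, and adds it to the vertical part of a vector over `v`. Thus `I₂` changes by minus the vertical
vector `[S_{Jv}, J] + J[S_v, J]` (`almostComplexTwo_eq_sub`). This depends only on `v`, and every
`v` is the projection of a vector tangent to `Z`.

If `s = 0`, then `S_X` commutes with `Q` and the change vanishes. Conversely, its vanishing at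
`J_0`, `J_1`, `J_2` gives `s_1(J_0 v) = s_2(v)`, `s_2(J_0 v) = -s_1(v)` and their cyclic
permutations. Then `s_2(v) = s_1(J_0 v) = s_0(J_2 J_0 v) = s_0(J_1 v) = -s_2(v)`, so `s_2 = 0`, and
the other components follow (`functionals_eq_zero`). -/

noncomputable section

/-! ### Algebra of quaternionic triples -/

section QuaternionicTriple

variable {A : Type*} [Ring A]

/-- Three elements of a ring that satisfy the relations of the imaginary quaternion units. -/
structure IsQuaternionicTriple (J : Fin 3 → A) : Prop where
  sq : ∀ a, J a * J a = -1
  mul₀₁ : J 0 * J 1 = J 2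
  mul₁₀ : J 1 * J 0 = -J 2

namespace IsQuaternionicTriple

variable {J : Fin 3 → A}

theorem mul₂₁ (h : IsQuaternionicTriple J) : J 2 * J 1 = -J 0 := by
  rw [← h.mul₀₁, mul_assoc, h.sq, mul_neg_one]

theorem mul₀₂ (h : IsQuaternionicTriple J) : J 0 * J 2 = -J 1 := by
  rw [← h.mul₀₁, ← mul_assoc, h.sq, neg_one_mul]

theorem mul₁₂ (h : IsQuaternionicTriple J) : J 1 * J 2 = J 0 := by
  rw [← h.mul₀₁, ← mul_assoc, h.mul₁₀, neg_mul, h.mul₂₁, neg_neg]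

theorem mul₂₀ (h : IsQuaternionicTriple J) : J 2 * J 0 = J 1 := by
  rw [← h.mul₀₁, mul_assoc, h.mul₁₀, mul_neg, h.mul₀₂, neg_neg]

/-- Cyclic symmetry of the relations: facts proved for `J 0` transfer to `J 1` and `J 2`. -/
theorem rotate (h : IsQuaternionicTriple J) : IsQuaternionicTriple ![J 1, J 2, J 0] where
  sq a := by fin_cases a <;> exact h.sq _
  mul₀₁ := h.mul₁₂
  mul₁₀ := h.mul₂₁

variable [Algebra ℝ A]

/-- Distinct units anticommute and squares are `-1`, so anticommuting with `J b` reads off the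
coefficient of `J b`. -/
theorem anticommutator_sum (h : IsQuaternionicTriple J) (t : Fin 3 → ℝ) (b : Fin 3) :
    (∑ a, t a • J a) * J b + J b * ∑ a, t a • J a = (-2 * t b) • 1 := by
  fin_cases b <;>
    simp only [Fin.sum_univ_three, add_mul, mul_add, smul_mul_assoc, mul_smul_comm, Fin.zero_eta,
      Fin.mk_one, Fin.reduceFinMk, h.sq, h.mul₀₁, h.mul₁₀, h.mul₀₂, h.mul₂₀, h.mul₁₂, h.mul₂₁] <;>
    module

theorem linearIndependent [Nontrivial A] (h : IsQuaternionicTriple J) :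
    LinearIndependent ℝ J := by
  rw [Fintype.linearIndependent_iff]
  intro t ht b
  have := h.anticommutator_sum t b
  rw [ht, zero_mul, mul_zero, add_zero] at this
  have h2 := (smul_eq_zero.1 this.symm).resolve_right one_ne_zero
  linarith

theorem commutator_zero (h : IsQuaternionicTriple J) (t : Fin 3 → ℝ) :
    (∑ a, t a • J a) * J 0 - J 0 * ∑ a, t a • J a = (2 * t 2) • J 1 - (2 * t 1) • J 2 := by
  simp only [Fin.sum_univ_three, add_mul, mul_add, smul_mul_assoc, mul_smul_comm,
    h.sq, h.mul₀₁, h.mul₁₀, h.mul₀₂, h.mul₂₀]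
  module

theorem commutator_one (h : IsQuaternionicTriple J) (t : Fin 3 → ℝ) :
    (∑ a, t a • J a) * J 1 - J 1 * ∑ a, t a • J a = (2 * t 0) • J 2 - (2 * t 2) • J 0 := by
  simp only [Fin.sum_univ_three, add_mul, mul_add, smul_mul_assoc, mul_smul_comm,
    h.sq, h.mul₀₁, h.mul₁₀, h.mul₁₂, h.mul₂₁]
  module

theorem commutator_two (h : IsQuaternionicTriple J) (t : Fin 3 → ℝ) :
    (∑ a, t a • J a) * J 2 - J 2 * ∑ a, t a • J a = (2 * t 1) • J 0 - (2 * t 0) • J 1 := by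
  simp only [Fin.sum_univ_three, add_mul, mul_add, smul_mul_assoc, mul_smul_comm,
    h.sq, h.mul₀₂, h.mul₂₀, h.mul₁₂, h.mul₂₁]
  module

theorem eq_zero_of_commutator_zero [Nontrivial A] (h : IsQuaternionicTriple J) {t : Fin 3 → ℝ}
    (ht : (∑ a, t a • J a) * J 0 - J 0 * ∑ a, t a • J a = 0) : t 1 = 0 ∧ t 2 = 0 := by
  rw [h.commutator_zero] at ht
  have := Fintype.linearIndependent_iff.1 h.linearIndependent ![0, 2 * t 2, -(2 * t 1)]
    (by simpa [Fin.sum_univ_three, sub_eq_add_neg] using ht)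
  have h1 := this 1
  have h2 := this 2
  simp at h1 h2
  exact ⟨h2, h1⟩

/-- Commuting with `J 0` kills the coefficients 1 and 2; the rotated statement for `J 1` kills
coefficient 0. -/
theorem eq_zero_of_commute [Nontrivial A] (h : IsQuaternionicTriple J) {t : Fin 3 → ℝ}
    (ht : ∀ b, Commute (∑ a, t a • J a) (J b)) : t = 0 := by
  have h0 := h.eq_zero_of_commutator_zero (sub_eq_zero.2 (ht 0).eq)
  have h1 := h.rotate.eq_zero_of_commutator_zero (t := ![t 1, t 2, t 0]) <| by
    have e : ∑ a, ![t 1, t 2, t 0] a • ![J 1, J 2, J 0] a = ∑ a, t a • J a := by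
      simp [Fin.sum_univ_three]; abel
    rw [e]
    exact sub_eq_zero.2 (ht 1).eq
  ext a
  fin_cases a
  exacts [h1.2, h0.1, h0.2]

/-- A derivation that preserves the span of the triple is skew-symmetric, hence inner. -/
theorem exists_commute_sub [Nontrivial A] (h : IsQuaternionicTriple J) {S : A}
    (hS : ∀ a, S * J a - J a * S ∈ Submodule.span ℝ (Set.range J)) :
    ∃ t : Fin 3 → ℝ, ∀ b, Commute (S - ∑ a, t a • J a) (J b) := by
  have hc : ∀ a, ∃ c : Fin 3 → ℝ, ∑ b, c b • J b = S * J a - J a * S :=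
    fun a => (Submodule.mem_span_range_iff_exists_fun ℝ).1 (hS a)
  choose c hc using hc
  -- Apply the derivation `[S, ·]` to the scalar `J a * J b + J b * J a`: the result is zero, and it
  -- is also `-2 (c a b + c b a)`.
  have key : ∀ a b (r : ℝ), J a * J b + J b * J a = r • 1 → c a b + c b a = 0 := by
    intro a b r hab
    have h1 := h.anticommutator_sum (c a) b
    have h2 := h.anticommutator_sum (c b) a
    rw [hc] at h1 h2
    have h3 : (S * J a - J a * S) * J b + J b * (S * J a - J a * S) +
        ((S * J b - J b * S) * J a + J a * (S * J b - J b * S)) =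
        S * (J a * J b + J b * J a) - (J a * J b + J b * J a) * S := by noncomm_ring
    rw [h1, h2, hab, mul_smul_comm, smul_mul_assoc, mul_one, one_mul, sub_self, ← add_smul] at h3
    have := (smul_eq_zero.1 h3).resolve_right one_ne_zero
    linarith
  have h00 := key 0 0 (-2) (by rw [h.sq]; module)
  have h11 := key 1 1 (-2) (by rw [h.sq]; module)
  have h22 := key 2 2 (-2) (by rw [h.sq]; module)
  have h01 := key 0 1 0 (by rw [h.mul₀₁, h.mul₁₀]; module)
  have h02 := key 0 2 0 (by rw [h.mul₀₂, h.mul₂₀]; module)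
  have h12 := key 1 2 0 (by rw [h.mul₁₂, h.mul₂₁]; module)
  -- The coefficients are found by matching `commutator_zero` and `commutator_one` with the rows of
  -- the skew matrix `c`.
  refine ⟨![c 1 2 / 2, -c 0 2 / 2, c 0 1 / 2], fun b => sub_eq_zero.1 ?_⟩
  have e : ∀ T : A, (S - T) * J b - J b * (S - T) =
      (S * J b - J b * S) - (T * J b - J b * T) := fun T => by noncomm_ring
  rw [e, ← hc]
  fin_cases b
  · refine (congrArg _ (h.commutator_zero _)).trans ?_
    simp only [Fin.sum_univ_three, Fin.zero_eta, Matrix.cons_val]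
    rw [show c 0 0 = 0 by linarith]
    module
  · refine (congrArg _ (h.commutator_one _)).trans ?_
    simp only [Fin.sum_univ_three, Fin.mk_one, Matrix.cons_val]
    rw [show c 1 1 = 0 by linarith, show c 1 0 = -c 0 1 by linarith]
    module
  · refine (congrArg _ (h.commutator_two _)).trans ?_
    simp only [Fin.sum_univ_three, Fin.reduceFinMk, Matrix.cons_val]
    rw [show c 2 2 = 0 by linarith, show c 2 0 = -c 0 2 by linarith,
      show c 2 1 = -c 1 2 by linarith]
    module

theorem eq_of_commute_sub [Nontrivial A] (h : IsQuaternionicTriple J) {S : A}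
    {t u : Fin 3 → ℝ} (ht : ∀ b, Commute (S - ∑ a, t a • J a) (J b))
    (hu : ∀ b, Commute (S - ∑ a, u a • J a) (J b)) : t = u := by
  refine sub_eq_zero.1 (h.eq_zero_of_commute fun b => ?_)
  have e : ∑ a, (t - u) a • J a = (S - ∑ a, u a • J a) - (S - ∑ a, t a • J a) := by
    simp [sub_smul, Finset.sum_sub_distrib]
  rw [e]
  exact (hu b).sub_left (ht b)

/-- The coefficients are chosen separately for each vector; uniqueness forces the choice to be
linear. -/
theorem exists_linearMap_commute_sub [Nontrivial A] (h : IsQuaternionicTriple J) {V : Type*}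
    [AddCommGroup V] [Module ℝ V] (S : V →ₗ[ℝ] A)
    (hS : ∀ v a, S v * J a - J a * S v ∈ Submodule.span ℝ (Set.range J)) :
    ∃ T : V →ₗ[ℝ] (Fin 3 → ℝ), ∀ v b, Commute (S v - ∑ a, T v a • J a) (J b) := by
  choose t ht using fun v => h.exists_commute_sub (hS v)
  refine ⟨⟨⟨t, fun v w => h.eq_of_commute_sub (ht (v + w)) fun b => ?_⟩,
    fun r v => h.eq_of_commute_sub (ht (r • v)) fun b => ?_⟩, ht⟩
  · have e : S (v + w) - ∑ a, (t v + t w) a • J a =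
        (S v - ∑ a, t v a • J a) + (S w - ∑ a, t w a • J a) := by
      simp only [map_add, Pi.add_apply, add_smul, Finset.sum_add_distrib]
      abel
    rw [e]
    exact (ht v b).add_left (ht w b)
  · have e : S (r • v) - ∑ a, (r • t v) a • J a = r • (S v - ∑ a, t v a • J a) := by
      simp [smul_sub, Finset.smul_sum, mul_smul]
    exact e ▸ (ht v b).smul_left r

/-- This is the equality of the two `I₂` at the point `J 0`, with `t = s(v)` and `u = s(J_0 v)`.
Both terms lie in the span of `J 1` and `J 2`, where coefficients are compared. -/
theorem eq_of_commutator_add_eq_zero [Nontrivial A] (h : IsQuaternionicTriple J)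
    {t u : Fin 3 → ℝ}
    (htu : ((∑ a, u a • J a) * J 0 - J 0 * ∑ a, u a • J a) +
      J 0 * ((∑ a, t a • J a) * J 0 - J 0 * ∑ a, t a • J a) = 0) :
    u 1 = t 2 ∧ u 2 = -t 1 := by
  rw [h.commutator_zero, h.commutator_zero, mul_sub, mul_smul_comm, mul_smul_comm, h.mul₀₁,
    h.mul₀₂] at htu
  have := Fintype.linearIndependent_iff.1 h.linearIndependent
    ![0, 2 * u 2 + 2 * t 1, 2 * t 2 - 2 * u 1]
    (by simp only [Fin.sum_univ_three, Matrix.cons_val]; rw [← htu]; module)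
  have h1 := this 1
  have h2 := this 2
  simp only [Matrix.cons_val] at h1 h2
  constructor <;> linarith

end IsQuaternionicTriple

/-- Functionals `s` on a real vector space with a quaternionic triple `J` of endomorphisms vanish
if `[s(J_a v), J_a] + J_a [s(v), J_a] = 0` for all `a` and `v`, where `s(v) = ∑ s_a(v) J_a`. -/
theorem IsQuaternionicTriple.functionals_eq_zero {V : Type*} [Algebra ℝ A] [Nontrivial A]
    {J : Fin 3 → A} (h : IsQuaternionicTriple J) (act : A → V → V)
    (hact : ∀ v, act (J 2) (act (J 0) v) = act (J 1) v)
    {s : Fin 3 → V → ℝ}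
    (hs : ∀ b v, ((∑ a, s a (act (J b) v) • J a) * J b - J b * ∑ a, s a (act (J b) v) • J a) +
      J b * ((∑ a, s a v • J a) * J b - J b * ∑ a, s a v • J a) = 0) (a : Fin 3) (v : V) :
    s a v = 0 := by
  have h0 := fun v => h.eq_of_commutator_add_eq_zero (t := fun a => s a v)
    (u := fun a => s a (act (J 0) v)) (hs 0 v)
  have e1 : ∀ v, ∑ a, ![s 1 v, s 2 v, s 0 v] a • ![J 1, J 2, J 0] a = ∑ a, s a v • J a := by
    intro v; simp [Fin.sum_univ_three]; abel
  have e2 : ∀ v, ∑ a, ![s 2 v, s 0 v, s 1 v] a • ![J 2, J 0, J 1] a = ∑ a, s a v • J a := by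
    intro v; simp [Fin.sum_univ_three]; abel
  have h1 := fun v => h.rotate.eq_of_commutator_add_eq_zero (t := ![s 1 v, s 2 v, s 0 v])
    (u := ![s 1 (act (J 1) v), s 2 (act (J 1) v), s 0 (act (J 1) v)])
    (by rw [e1, e1]; exact hs 1 v)
  have h2 := fun v => h.rotate.rotate.eq_of_commutator_add_eq_zero (t := ![s 2 v, s 0 v, s 1 v])
    (u := ![s 2 (act (J 2) v), s 0 (act (J 2) v), s 1 (act (J 2) v)])
    (by
      have := hs 2 v
      rw [← e2, ← e2] at this
      exact this)
  simp only [Matrix.cons_val] at h0 h1 h2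
  -- The chain `s_2(v) = s_1(J_0 v) = s_0(J_2 J_0 v) = s_0(J_1 v) = -s_2(v)`.
  have hz : ∀ v, s 2 v = 0 := by
    intro v
    have e3 := (h0 v).1
    have e4 := (h2 (act (J 0) v)).1
    rw [hact] at e4
    have e5 := (h1 v).2
    linarith
  have hz1 : ∀ v, s 1 v = 0 := fun v => by
    have := (h0 v).2
    rw [hz] at this
    linarith
  have hz0 : ∀ v, s 0 v = 0 := fun v => by
    rw [← (h1 v).1, hz]
  fin_cases a
  exacts [hz0 v, hz1 v, hz v]

end QuaternionicTriple

/-! ### The difference tensor and the change of `I₂` -/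

section Quaternionic

variable {n : ℕ} {M : Type*} [TopologicalSpace M] [ChartedSpace (QModel n) M]
  [IsManifold (𝓡 (4 * n)) ∞ M]

/-- Differentiability of a vector field at a point. -/
abbrev MDifferentiableFieldAt (Y : ∀ y : M, TangentSpace (𝓡 (4 * n)) y) (x : M) : Prop :=
  MDifferentiableAt (𝓡 (4 * n)) ((𝓡 (4 * n)).prod 𝓘(ℝ, QModel n))
    (fun y => (⟨y, Y y⟩ : TotalSpace (QModel n) (TangentSpace (𝓡 (4 * n)) : M → Type _))) x

section DifferenceTensor

variable (D D' : TangentConnection n M)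

instance finiteDimensional_tangentSpace (x : M) :
    FiniteDimensional ℝ (TangentSpace (𝓡 (4 * n)) x) :=
  inferInstanceAs (FiniteDimensional ℝ (QModel n))

instance t2Space_tangentSpace (x : M) : T2Space (TangentSpace (𝓡 (4 * n)) x) :=
  inferInstanceAs (T2Space (QModel n))

/-- The difference tensor of two connections, as an endomorphism-valued one-form. -/
def diffForm (x : M) : TangentSpace (𝓡 (4 * n)) x →L[ℝ] EndFiber n x :=
  LinearMap.toContinuousLinearMap
    { toFun v := LinearMap.toContinuousLinearMap
        { toFun w := D'.difference D x w v
          map_add' _ _ := by simp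
          map_smul' _ _ := by simp }
      map_add' _ _ := by ext1; simp
      map_smul' _ _ := by ext1; simp }

theorem diffForm_apply (x : M) (v w : TangentSpace (𝓡 (4 * n)) x) :
    diffForm D D' x v w = diffTensor D D' x v w := rfl

variable {D D'}

theorem diffForm_apply_section {x : M} {Y : ∀ y : M, TangentSpace (𝓡 (4 * n)) y}
    (hY : MDifferentiableFieldAt Y x) (v : TangentSpace (𝓡 (4 * n)) x) :
    diffForm D D' x v (Y x) = D' Y x v - D Y x v :=
  DFunLike.congr_fun (D'.isCovariantDerivativeOnUniv.difference_apply
    D.isCovariantDerivativeOnUniv (Set.mem_univ x) hY) v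

theorem endDeriv_apply_section {σ : ∀ x : M, EndFiber n x} {x : M}
    (hσ : MDifferentiableAt (𝓡 (4 * n)) (endModel n) (endSection σ) x)
    {Y : ∀ y : M, TangentSpace (𝓡 (4 * n)) y} (hY : MDifferentiableFieldAt Y x)
    (v : TangentSpace (𝓡 (4 * n)) x) :
    endDeriv D σ x hσ v (Y x) = D (fun y => σ y (Y y)) x v - σ x (D Y x v) :=
  TensorialAt.mkHom_apply (endDeriv_tensorial D σ x hσ v) hY

/-- Expand `∇'(σY) - σ(∇'Y)` with `∇' = ∇ + S`; the terms in `S` form the commutator. -/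
theorem endDeriv_eq_add_commutator {σ : ∀ x : M, EndFiber n x} {x : M}
    (hσ : MDifferentiableAt (𝓡 (4 * n)) (endModel n) (endSection σ) x)
    (v : TangentSpace (𝓡 (4 * n)) x) :
    endDeriv D' σ x hσ v =
      endDeriv D σ x hσ v + (diffForm D D' x v * σ x - σ x * diffForm D D' x v) := by
  ext1 w
  have hw := FiberBundle.mdifferentiableAt_extend (𝓡 (4 * n)) (QModel n) w
  have hσw := MDifferentiableAt.clm_bundle_apply (b := fun y : M => y) (ϕ := σ) hσ hw
  -- Forgetting which extension `Y` is allows `w` to be replaced by `Y x` everywhere.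
  obtain ⟨Y, hYw, hY, hσY⟩ : ∃ Y : ∀ y : M, TangentSpace (𝓡 (4 * n)) y, Y x = w ∧
      MDifferentiableFieldAt Y x ∧ MDifferentiableFieldAt (fun y => σ y (Y y)) x :=
    ⟨_, FiberBundle.extend_apply_self _ w, hw, hσw⟩
  subst hYw
  have h1 := diffForm_apply_section (D := D) (D' := D') hσY v
  have h2 := diffForm_apply_section (D := D) (D' := D') hY v
  have e : ((diffForm D D' x v * σ x - σ x * diffForm D D' x v : EndFiber n x) : _) (Y x) =
      diffForm D D' x v (σ x (Y x)) - σ x (diffForm D D' x v (Y x)) := rfl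
  rw [add_apply, e, h1, h2, endDeriv_apply_section hσ hY,
    endDeriv_apply_section hσ hY, map_sub]
  abel

theorem vertVec_add (p : EndTotal n M) (A B : EndFiber n p.1) :
    vertVec p (A + B) = vertVec p A + vertVec p B := by
  rw [vertVec_eq, vertVec_eq, vertVec_eq]
  exact Prod.ext (add_zero _).symm rfl

theorem vertVec_eq_zero_iff {p : EndTotal n M} {A : EndFiber n p.1} :
    vertVec p A = 0 ↔ A = 0 := by
  rw [vertVec_eq]
  exact ⟨fun h => congrArg Prod.snd h, fun h => Prod.ext rfl h⟩

/-- The term `dσ(v)` does not involve the connection, and the change of `∇_v σ` involves only the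
value `σ x = p.2`. -/
theorem horLift_eq_sub (p : EndTotal n M) (v : TangentSpace (𝓡 (4 * n)) p.1) :
    horLift D' p v = horLift D p v -
      vertVec p (diffForm D D' p.1 v * p.2 - p.2 * diffForm D D' p.1 v) := by
  have h := endDeriv_eq_add_commutator (D := D) (D' := D')
    (FiberBundle.mdifferentiableAt_extend (𝓡 (4 * n)) (QModel n →L[ℝ] QModel n) p.2) v
  rw [FiberBundle.extend_apply_self] at h
  unfold horLift
  dsimp only
  erw [h]
  rw [vertVec_add]
  exact sub_add_eq_sub_sub (α := TangentSpace (endModel n) p) _ _ _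

theorem eq_horLift_add_vertVec_vertPart (p : EndTotal n M) (W : TangentSpace (endModel n) p) :
    W = horLift D p (projDeriv p W) + vertVec p (vertPart D p W) :=
  (existsUnique_vert D p W).choose_spec.1

/-- The vector `W` is fixed, so its vertical part absorbs what the horizontal lift loses. -/
theorem vertPart_eq_add (p : EndTotal n M) (W : TangentSpace (endModel n) p) :
    vertPart D' p W = vertPart D p W + (diffForm D D' p.1 (projDeriv p W) * p.2 -
      p.2 * diffForm D D' p.1 (projDeriv p W)) := by
  refine (existsUnique_vert D' p W).unique (eq_horLift_add_vertVec_vertPart p W) ?_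
  rw [horLift_eq_sub (D := D), vertVec_add]
  refine (eq_horLift_add_vertVec_vertPart (D := D) p W).trans ?_
  abel

/-- The change of the almost complex structure `I₂` under a change of the connection, as an
endomorphism of the tangent space of the base. -/
def changeTwo (D D' : TangentConnection n M) (x : M) (J : EndFiber n x)
    (v : TangentSpace (𝓡 (4 * n)) x) : EndFiber n x :=
  (diffForm D D' x (J v) * J - J * diffForm D D' x (J v)) +
    J * (diffForm D D' x v * J - J * diffForm D D' x v)

theorem almostComplexTwo_eq_sub (p : EndTotal n M) (W : TangentSpace (endModel n) p) :
    almostComplexTwo D' p W =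
      almostComplexTwo D p W - vertVec p (changeTwo D D' p.1 p.2 (projDeriv p W)) := by
  have h1 := horLift_eq_sub (D := D) (D' := D') p (p.2 (projDeriv p W))
  have h2 : vertVec p (p.2.comp (vertPart D' p W)) = vertVec p (p.2.comp (vertPart D p W)) +
    vertVec p (p.2 * (diffForm D D' p.1 (projDeriv p W) * p.2 -
      p.2 * diffForm D D' p.1 (projDeriv p W))) := by
    rw [← vertVec_add, vertPart_eq_add (D := D) (D' := D')]
    exact congrArg (vertVec p) (mul_add p.2 _ _)
  have h3 : vertVec p (changeTwo D D' p.1 p.2 (projDeriv p W)) = _ := vertVec_add p _ _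
  have h4 : ∀ {G : Type _} [AddCommGroup G] {a b c d a' e : G}, a' = a - b → e = c + d →
      a' - e = a - c - (b + d) := by
    rintro G _ a b c d _ _ rfl rfl
    abel
  rw [h3]
  unfold almostComplexTwo
  exact h4 h1 h2

theorem almostComplexTwo_eq_iff (p : EndTotal n M) (W : TangentSpace (endModel n) p) :
    almostComplexTwo D p W = almostComplexTwo D' p W ↔
      changeTwo D D' p.1 p.2 (projDeriv p W) = 0 := by
  rw [almostComplexTwo_eq_sub (D := D) (D' := D'), eq_comm, sub_eq_self, vertVec_eq_zero_iff]

end DifferenceTensor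

/-! ### Tangent vectors of the twistor space over given vectors of the base -/

section Curves

/-- Every tangent vector of a manifold modelled on `QModel n` is the velocity of a smooth curve. -/
theorem exists_curve (x : M) (v : QModel n) :
    ∃ c : ℝ → M, c 0 = x ∧ ContMDiffAt 𝓘(ℝ, ℝ) (𝓡 (4 * n)) ∞ c 0 ∧
      HasMFDerivAt 𝓘(ℝ, ℝ) (𝓡 (4 * n)) c 0 (ContinuousLinearMap.toSpanSingleton ℝ v) := by
  -- The curve is a straight line in the preferred chart at `x`. That chart identifies `T_x M` with
  -- the model space, so the velocity is `v` itself.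
  let φ := extChartAt (𝓡 (4 * n)) x
  let l : ℝ → QModel n := fun t => φ x + t • v
  have hl0 : l 0 = φ x := by simp [l]
  have hls : ContDiff ℝ ∞ l := by fun_prop
  have hsymm : ContMDiffAt 𝓘(ℝ, QModel n) (𝓡 (4 * n)) ∞ φ.symm (l 0) := by
    rw [hl0]
    exact (contMDiffOn_extChartAt_symm x).contMDiffAt (extChartAt_target_mem_nhds x)
  have hc : ContMDiffAt 𝓘(ℝ, ℝ) (𝓡 (4 * n)) ∞ (φ.symm ∘ l) 0 :=
    hsymm.comp 0 hls.contDiffAt.contMDiffAt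
  have hc0 : (φ.symm ∘ l) 0 = x := by
    simp only [Function.comp_apply, hl0]
    exact extChartAt_to_inv x
  refine ⟨φ.symm ∘ l, hc0, hc, hc.continuousAt, ?_⟩
  have hd : HasFDerivAt l (ContinuousLinearMap.toSpanSingleton ℝ v) 0 := by
    have := ((hasDerivAt_id (0 : ℝ)).smul_const v).const_add (φ x)
    rw [one_smul] at this
    exact this.hasFDerivAt
  have he : ∀ᶠ t in 𝓝 (0 : ℝ), l t ∈ φ.target := by
    refine hls.continuous.continuousAt.eventually_mem ?_
    rw [hl0]
    exact extChartAt_target_mem_nhds x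
  have hw : ∀ t, writtenInExtChartAt 𝓘(ℝ, ℝ) (𝓡 (4 * n)) 0 (φ.symm ∘ l) t = φ (φ.symm (l t)) := by
    intro t
    simp only [writtenInExtChartAt, hc0, extChartAt_model_space_eq_id]
    rfl
  refine HasFDerivAt.hasFDerivWithinAt (HasFDerivAt.congr_of_eventuallyEq hd ?_)
  filter_upwards [he] with t ht
  exact (hw t).trans (φ.right_inv ht)

theorem exists_mem_twistorTangent_of_curve {Q : AlmostQuaternionicStructure n M}
    {p : EndTotal n M} {γ : ℝ → EndTotal n M} (h0 : γ 0 = p)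
    (hγ : ContMDiffAt 𝓘(ℝ, ℝ) (endModel n) ∞ γ 0)
    (hZ : ∀ᶠ t in 𝓝 (0 : ℝ), γ t ∈ twistorSpace Q) {v : QModel n}
    (hv : HasMFDerivAt 𝓘(ℝ, ℝ) (𝓡 (4 * n)) (fun t => (γ t).1) 0
      (ContinuousLinearMap.toSpanSingleton ℝ v)) :
    ∃ W ∈ twistorTangent Q p, projDeriv p W = v := by
  subst h0
  refine ⟨_, Submodule.subset_span ⟨γ, hγ, hZ, rfl⟩, ?_⟩
  have h1 := (hγ.mdifferentiableAt (by simp)).hasMFDerivAt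
  have h2 := (Bundle.mdifferentiableAt_proj (IB := 𝓡 (4 * n)) (F := QModel n →L[ℝ] QModel n)
    (fun x : M => EndFiber n x) (p := γ 0)).hasMFDerivAt
  have h3 := hasMFDerivAt_unique (h2.comp (0 : ℝ) h1) hv
  refine (DFunLike.congr_fun h3 (1 : ℝ)).trans ?_
  exact one_smul ℝ v

theorem IsAdmissibleBasis.mem_twistorSpace {Q : AlmostQuaternionicStructure n M} {U : Set M}
    {J : Fin 3 → ∀ x : M, EndFiber n x} (h : IsAdmissibleBasis Q.fiber U J) (a : Fin 3) {x : M}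
    (hx : x ∈ U) : endSection (J a) x ∈ twistorSpace Q := by
  refine ⟨?_, h.sq a x hx⟩
  change J a x ∈ Q.fiber x
  rw [← h.span x hx]
  exact Submodule.subset_span ⟨a, rfl⟩

theorem IsAdmissibleBasis.contMDiffAt {Q : AlmostQuaternionicStructure n M} {U : Set M}
    {J : Fin 3 → ∀ x : M, EndFiber n x} (h : IsAdmissibleBasis Q.fiber U J) (a : Fin 3) {x : M}
    (hx : x ∈ U) : ContMDiffAt (𝓡 (4 * n)) (endModel n) ∞ (endSection (J a)) x :=
  (h.smooth a).contMDiffAt (h.isOpen.mem_nhds hx)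

/-- The section `J a` takes values in `Z` over `U`; composing it with a curve of velocity `v` gives
a curve in `Z` that projects to that curve. -/
theorem IsAdmissibleBasis.exists_mem_twistorTangent {Q : AlmostQuaternionicStructure n M}
    {U : Set M} {J : Fin 3 → ∀ x : M, EndFiber n x} (h : IsAdmissibleBasis Q.fiber U J)
    (a : Fin 3) {x : M} (hx : x ∈ U) (v : TangentSpace (𝓡 (4 * n)) x) :
    ∃ W ∈ twistorTangent Q (endSection (J a) x), projDeriv (endSection (J a) x) W = v := by
  obtain ⟨c, hc0, hc, hcv⟩ := exists_curve x v
  refine exists_mem_twistorTangent_of_curve (γ := endSection (J a) ∘ c)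
    (congrArg (endSection (J a)) hc0) ?_ ?_ hcv
  · refine ContMDiffAt.comp (0 : ℝ) ?_ hc
    rw [hc0]
    exact h.contMDiffAt a hx
  · filter_upwards [hc.continuousAt.eventually_mem (by rw [hc0]; exact h.isOpen.mem_nhds hx)]
      with t ht
    exact h.mem_twistorSpace a ht

end Curves

/-! ### Components of the difference tensor and the equivalence -/

section Components

variable {Q : AlmostQuaternionicStructure n M} {D D' : TangentConnection n M} {U : Set M}
  {J : Fin 3 → ∀ x : M, EndFiber n x} {x : M}

/-- Rank 3 excludes the degenerate case of zero-dimensional tangent spaces, where `1 = 0` in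
`EndFiber`. -/
theorem AlmostQuaternionicStructure.nontrivial_endFiber (Q : AlmostQuaternionicStructure n M)
    (x : M) : Nontrivial (EndFiber n x) := by
  by_contra hn
  rw [not_nontrivial_iff_subsingleton] at hn
  have := Q.rank_eq x
  rw [Module.finrank_zero_of_subsingleton] at this
  omega

theorem IsAdmissibleBasis.isQuaternionicTriple {Q : ∀ x : M, Submodule ℝ (EndFiber n x)}
    (h : IsAdmissibleBasis Q U J) (hx : x ∈ U) :
    IsQuaternionicTriple (fun a => J a x) where
  sq a := h.sq a x hx
  mul₀₁ := h.mul₁₂ x hx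
  mul₁₀ := h.mul₂₁ x hx

theorem diffForm_commutator_mem (hD : IsQuaternionicConnection Q D)
    (hD' : IsQuaternionicConnection Q D') (h : IsAdmissibleBasis Q.fiber U J) (hx : x ∈ U)
    (a : Fin 3) (v : TangentSpace (𝓡 (4 * n)) x) :
    diffForm D D' x v * J a x - J a x * diffForm D D' x v ∈
      Submodule.span ℝ (Set.range fun a => J a x) := by
  have hJ := (h.contMDiffAt a hx).mdifferentiableAt (by simp)
  rw [h.span x hx, ← sub_eq_of_eq_add' (endDeriv_eq_add_commutator hJ v)]
  exact sub_mem
    (hD'.preserves U _ h.isOpen (h.smooth a) (fun y hy => (h.mem_twistorSpace a hy).1) x hx hJ v)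
    (hD.preserves U _ h.isOpen (h.smooth a) (fun y hy => (h.mem_twistorSpace a hy).1) x hx hJ v)

/-- The tensor `S₀` is forced to be `S - ∑ s_a J_a`, so the existential reduces to a commutation
condition. -/
theorem isSpOneComponents_iff {J : Fin 3 → EndFiber n x}
    {s : Fin 3 → (TangentSpace (𝓡 (4 * n)) x →L[ℝ] ℝ)} :
    IsSpOneComponents D D' x J s ↔
      ∀ v b, Commute (diffForm D D' x v - ∑ a, s a v • J a) (J b) := by
  constructor
  · rintro ⟨S₀, hS₀, hS⟩ v b
    have e : diffForm D D' x v - ∑ a, s a v • J a = S₀ v := by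
      rw [sub_eq_iff_eq_add]
      ext1 w
      rw [diffForm_apply, hS]
      simp
    rw [e]
    exact hS₀ v b
  · intro h
    refine ⟨diffForm D D' x - ∑ a, (s a).smulRight (J a), fun v b => ?_, fun v w => ?_⟩
    · have := (h v b).eq
      simpa [← ContinuousLinearMap.mul_def] using this
    · rw [← diffForm_apply]
      simp

theorem IsSpOneComponents.commutator {J : Fin 3 → EndFiber n x}
    {s : Fin 3 → (TangentSpace (𝓡 (4 * n)) x →L[ℝ] ℝ)} (hs : IsSpOneComponents D D' x J s)
    (v : TangentSpace (𝓡 (4 * n)) x) (b : Fin 3) :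
    diffForm D D' x v * J b - J b * diffForm D D' x v =
      (∑ a, s a v • J a) * J b - J b * ∑ a, s a v • J a := by
  have := (isSpOneComponents_iff.1 hs v b).eq
  rw [sub_mul, mul_sub] at this
  rw [sub_eq_sub_iff_add_eq_add, add_comm] at this ⊢
  rw [this, add_comm]

theorem existsUnique_isSpOneComponents (hD : IsQuaternionicConnection Q D)
    (hD' : IsQuaternionicConnection Q D') (h : IsAdmissibleBasis Q.fiber U J) (hx : x ∈ U) :
    ∃! s : Fin 3 → (TangentSpace (𝓡 (4 * n)) x →L[ℝ] ℝ),
      IsSpOneComponents D D' x (fun a => J a x) s := by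
  have := Q.nontrivial_endFiber x
  have hJ := h.isQuaternionicTriple hx
  obtain ⟨T, hT⟩ := hJ.exists_linearMap_commute_sub (diffForm D D' x).toLinearMap
    fun v a => diffForm_commutator_mem hD hD' h hx a v
  let s : Fin 3 → (TangentSpace (𝓡 (4 * n)) x →L[ℝ] ℝ) := fun a =>
    LinearMap.toContinuousLinearMap
      { toFun v := T v a
        map_add' v w := by rw [map_add]; rfl
        map_smul' r v := by rw [map_smul]; rfl }
  have hsT : ∀ v a, s a v = T v a := fun _ _ => rfl
  have hs : IsSpOneComponents D D' x (fun a => J a x) s := by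
    refine isSpOneComponents_iff.2 fun v b => ?_
    simp only [hsT]
    exact hT v b
  refine ⟨s, hs, fun u hu => ?_⟩
  funext a
  ext v
  exact congrFun (hJ.eq_of_commute_sub (isSpOneComponents_iff.1 hu v)
    (isSpOneComponents_iff.1 hs v)) a

/-- Only the points `J b x` of the twistor fibre are tested, each with tangent vectors over
arbitrary `w`. -/
theorem eq_zero_of_sameAlmostComplexTwo (hsame : SameAlmostComplexTwo Q D D')
    (h : IsAdmissibleBasis Q.fiber U J) (hx : x ∈ U)
    {s : Fin 3 → (TangentSpace (𝓡 (4 * n)) x →L[ℝ] ℝ)}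
    (hs : IsSpOneComponents D D' x (fun a => J a x) s) (a : Fin 3) : s a = 0 := by
  have := Q.nontrivial_endFiber x
  have hJ := h.isQuaternionicTriple hx
  ext v
  refine hJ.functionals_eq_zero (fun A w => A w)
    (fun w => DFunLike.congr_fun hJ.mul₂₀ w) (s := fun a w => s a w) (fun b w => ?_) a v
  obtain ⟨W, hW, hWw⟩ := h.exists_mem_twistorTangent b hx w
  have hc := (almostComplexTwo_eq_iff _ W).1 (hsame _ (h.mem_twistorSpace b hx) W hW)
  rw [hWw] at hc
  exact (congrArg₂ (fun A B => A + J b x * B) (hs.commutator _ b).symm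
    (hs.commutator _ b).symm).trans hc

theorem sameAlmostComplexTwo_of_commute
    (hcomm : ∀ (x : M) (v : TangentSpace (𝓡 (4 * n)) x), ∀ A ∈ Q.fiber x,
      Commute (diffForm D D' x v) A) :
    SameAlmostComplexTwo Q D D' := by
  intro p hp W _
  rw [almostComplexTwo_eq_iff, changeTwo, sub_eq_zero.2 (hcomm _ _ _ hp.1).eq,
    sub_eq_zero.2 (hcomm _ _ _ hp.1).eq, mul_zero, add_zero]

end Components

end Quaternionic

theorem corollaryt2p72 (n : ℕ) {M : Type*} [TopologicalSpace M] [ChartedSpace (QModel n) M]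
    [IsManifold (𝓡 (4 * n)) ∞ M] [T2Space M] [SecondCountableTopology M]
    (Q : AlmostQuaternionicStructure n M) (D D' : TangentConnection n M)
    (hD : IsQuaternionicConnection Q D) (hD' : IsQuaternionicConnection Q D') :
    (∀ (U : Set M) (J : Fin 3 → ∀ x : M, EndFiber n x), IsAdmissibleBasis Q.fiber U J →
      ∀ x ∈ U, ∃! s : Fin 3 → (TangentSpace (𝓡 (4 * n)) x →L[ℝ] ℝ),
        IsSpOneComponents D D' x (fun a => J a x) s) ∧
    (SameAlmostComplexTwo Q D D' ↔
      ∀ (U : Set M) (J : Fin 3 → ∀ x : M, EndFiber n x), IsAdmissibleBasis Q.fiber U J →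
        ∀ x ∈ U, ∀ s : Fin 3 → (TangentSpace (𝓡 (4 * n)) x →L[ℝ] ℝ),
          IsSpOneComponents D D' x (fun a => J a x) s → ∀ a, s a = 0) := by
  refine ⟨fun U J h x hx => existsUnique_isSpOneComponents hD hD' h hx,
    fun hsame U J h x hx s hs a => eq_zero_of_sameAlmostComplexTwo hsame h hx hs a,
    fun hzero => sameAlmostComplexTwo_of_commute fun x v A hA => ?_⟩
  obtain ⟨U, J, hx, h⟩ := Q.exists_basis x
  obtain ⟨s, hs, -⟩ := existsUnique_isSpOneComponents hD hD' h hx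
  have hs0 := hzero U J h x hx s hs
  rw [← h.span x hx] at hA
  -- Commuting with `S_v` is a linear condition on `A`, so it suffices to check it on the `J b x`,
  -- where `s = 0` leaves `S = S₀`.
  induction hA using Submodule.span_induction with
  | mem A hA =>
    obtain ⟨b, rfl⟩ := hA
    simpa [hs0] using isSpOneComponents_iff.1 hs v b
  | zero => exact Commute.zero_right _
  | add A B _ _ hA hB => exact hA.add_right hB
  | smul r A _ hA => exact hA.smul_right r

end
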